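/- Let $X$ be a non-empty compact metric space and let $\mathcal{K}(X)$ be the set of non-empty compact subsets of $X$ with the Hausdorff metric; give $\mathcal{K}(X)\times(0,1)$ the product topology. For $E\subseteq X$ and $r>0$ let $N(E,r)$ be the minimal number of closed balls of radius $r$, with centres in $X$, needed to cover $E$, and let $B(x,R)$ be the open ball of centre $x$ and radius $R$. For $F\in\mathcal{K}(X)$ and $\theta\in(0,1)$, the Assouad spectrum is \[ \dim_{\mathrm A}^{\theta}F=\inf\Big\{\alpha\in\mathbb{R} : (\exists C>0)(\exists\rho>0)(\forall\,0<R\le\rho)(\forall x\in F)\ \ N\big(B(x,R)\cap F,\,R^{1/\theta}\big)\le C\Big(\frac{R}{R^{1/\theta}}\Big)^{\alpha}\Big\}, \] an element of the extended real line $[-\infty,\infty]$, with value $+\infty$ if no such $\alpha$ exists. A function between two topological spaces is of Baire class $0$ if it is continuous, and of Baire class $n+1$ if it is the pointwise limit of a sequence of functions of Baire class $n$. Then the map $\Delta_{\mathrm A}:\mathcal{K}(X)\times(0,1)\to[-\infty,\infty]$, $\Delta_{\mathrm A}(F,\theta)=\dim_{\mathrm A}^{\theta}F$, is of Baire class $2$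 and Borel measurable. If all its values are finite, then it is also of Baire class $2$ and Borel measurable as a function into $\mathbb{R}$. In general $\Delta_{\mathrm A}$ is not of Baire class $1$: there is a non-empty compact metric space $X$ for which all values of $\Delta_{\mathrm A}$ are finite and $\Delta_{\mathrm A}$ is not of Baire class $1$, neither as a function into $\mathbb{R}$ nor as a function into $[-\infty,\infty]$. -/

import Mathlib

open Set Filter Topology TopologicalSpace
open scoped ENNReal NNReal

/-- `AssouadSpectrumBound F θ α`: there are `C > 0` and `ρ > 0` such that for all `0 < R ≤ ρ` and all
`x ∈ F`, the set `B(x, R) ∩ F` is covered by at most `C (R / R^(1/θ))^α` closed balls of radius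
`R^(1/θ)`.  Here `Metric.externalCoveringNumber r E` is the minimal number of closed `r`-balls,
with centres anywhere in the ambient space, needed to cover `E`. -/
def AssouadSpectrumBound {X : Type*} [MetricSpace X] (F : Set X) (θ α : ℝ) : Prop :=
  ∃ C > (0 : ℝ), ∃ ρ > (0 : ℝ), ∀ R : ℝ, 0 < R → R ≤ ρ → ∀ x ∈ F,
    ((Metric.externalCoveringNumber (R ^ (1 / θ)).toNNReal (Metric.ball x R ∩ F) : ℕ∞) : ℝ≥0∞) ≤
      ENNReal.ofReal (C * (R / R ^ (1 / θ)) ^ α)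

/-- The Assouad spectrum `dim_A^θ F`, the infimum of the admissible real exponents `α`, taken in the
extended reals (so that it is `⊤` if there is no admissible exponent). -/
noncomputable def assouadSpectrum {X : Type*} [MetricSpace X] (F : Set X) (θ : ℝ) : EReal :=
  ⨅ (α : ℝ) (_ : AssouadSpectrumBound F θ α), (α : EReal)

/-- The map `(F, θ) ↦ dim_A^θ F` on `𝒦(X) × (0,1)`, where `𝒦(X)` is the space of nonempty compact
subsets of `X` with the Hausdorff metric. -/
noncomputable def assouadSpectrumMap (X : Type*) [MetricSpace X] :
    NonemptyCompacts X × Ioo (0 : ℝ) 1 → EReal :=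
  fun p => assouadSpectrum (p.1 : Set X) (p.2 : ℝ)

/-- The Baire hierarchy: class `0` consists of the continuous functions, class `n + 1` of the pointwise
limits of sequences of functions of class `n`. -/
def IsBaireClass {A B : Type*} [TopologicalSpace A] [TopologicalSpace B] : ℕ → (A → B) → Prop
  | 0, f => Continuous f
  | n + 1, f => ∃ g : ℕ → A → B, (∀ k, IsBaireClass n (g k)) ∧
      ∀ a, Tendsto (fun k => g k a) atTop (𝓝 (f a))

/-! Since `R / R ^ (1 / θ)` tends to infinity as `R → 0`, a constant `C` is absorbed by any increase
of the exponent. So the spectrum is the limit in `n` of the least exponent in `[0, n]` that works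
with `C = 1` for all `R ≤ 1 / (n + 1)`, or `n` if none does. At a fixed scale the bound with `C = 1`
is a closed condition on `(F, θ, α)`: the centres of the covering balls live in a power of the
compact space `X`, the covered ball is open and the covering balls are closed. Hence these least
exponents are lower semicontinuous and nonnegative, so of class 1, and their limit is of class 2.

For sharpness, Cantor space is mapped continuously into the compact subsets of `[0, 1]`: each `n`
with `ω n = true` contributes a progression of `n + 1` points near `0`. At `θ = 1 / 2` the spectrum
is at most 0 for finitely many such `n` and at least 1 for infinitely many. Both kinds of `ω` are
dense, and Baire category excludes class 1. -/

/-! ### Baire classes and semicontinuity -/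

theorem IsBaireClass.comp_continuous {A B D : Type*} [TopologicalSpace A] [TopologicalSpace B]
    [TopologicalSpace D] {n : ℕ} {f : A → B} (hf : IsBaireClass n f) {g : D → A}
    (hg : Continuous g) : IsBaireClass n (f ∘ g) := by
  induction n generalizing f with
  | zero => exact Continuous.comp hf hg
  | succ n ih =>
    obtain ⟨u, hu, hlim⟩ := hf
    exact ⟨fun k => u k ∘ g, fun k => ih (hu k), fun a => hlim (g a)⟩

theorem IsBaireClass.continuous_comp {A B D : Type*} [TopologicalSpace A] [TopologicalSpace B]
    [TopologicalSpace D] {n : ℕ} {f : A → B} (hf : IsBaireClass n f) {g : B → D}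
    (hg : Continuous g) : IsBaireClass n (g ∘ f) := by
  induction n generalizing f with
  | zero => exact Continuous.comp hg hf
  | succ n ih =>
    obtain ⟨u, hu, hlim⟩ := hf
    exact ⟨fun k => g ∘ u k, fun k => ih (hu k), fun a => (hg.tendsto _).comp (hlim a)⟩

theorem IsBaireClass.measurable_borel {A B : Type*} [TopologicalSpace A] [TopologicalSpace B]
    [PseudoMetrizableSpace B] {n : ℕ} {f : A → B} (hf : IsBaireClass n f) :
    @Measurable A B (borel A) (borel B) f := by
  borelize A B
  induction n generalizing f with
  | zero => exact Continuous.measurable hf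
  | succ n ih =>
    obtain ⟨u, hu, hlim⟩ := hf
    exact measurable_of_tendsto_metrizable (fun k => ih (hu k)) (tendsto_pi_nhds.2 hlim)

/-- A lower semicontinuous function that is bounded below is the pointwise limit of its
Lipschitz regularizations `z ↦ ⨅ w, f w + k * dist z w`. -/
theorem LowerSemicontinuous.isBaireClass_one {Z : Type*} [PseudoMetricSpace Z] {f : Z → ℝ}
    (hf : LowerSemicontinuous f) (h0 : ∀ z, 0 ≤ f z) : IsBaireClass 1 f := by
  have hbdd : ∀ (k : ℕ) (z : Z), BddBelow (range fun w => f w + k * dist z w) := fun k z =>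
    ⟨0, by rintro _ ⟨w, rfl⟩; have := h0 w; positivity⟩
  refine ⟨fun k z => ⨅ w, f w + k * dist z w, fun k => ?_, fun z => ?_⟩
  · refine (LipschitzWith.of_le_add_mul (k : ℝ≥0) fun z z' => ?_).continuous
    have : Nonempty Z := ⟨z⟩
    rw [← sub_le_iff_le_add]
    refine le_ciInf fun w => ?_
    have h1 := ciInf_le (hbdd k z) w
    have h2 : (k : ℝ) * dist z w ≤ k * (dist z z' + dist z' w) := by
      gcongr; exact dist_triangle _ _ _
    simp only [NNReal.coe_natCast]
    linarith
  · have : Nonempty Z := ⟨z⟩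
    have hle : ∀ k : ℕ, (⨅ w, f w + k * dist z w) ≤ f z := fun k => by
      simpa using ciInf_le (hbdd k z) z
    refine tendsto_order.2 ⟨fun a ha => ?_, fun a ha => .of_forall fun k => (hle k).trans_lt ha⟩
    obtain ⟨b, hab, hb⟩ := exists_between ha
    obtain ⟨δ, hδ, hball⟩ := Metric.eventually_nhds_iff.1 (hf z b hb)
    -- Within `δ` of `z` semicontinuity keeps `f` above `b`; farther away the penalty `k * dist z w`
    -- alone exceeds `f z` once `k ≥ f z / δ`.
    obtain ⟨m, hm⟩ := exists_nat_ge (f z / δ)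
    filter_upwards [eventually_ge_atTop m] with k hk
    refine hab.trans_le (le_ciInf fun w => ?_)
    rcases lt_or_ge (dist w z) δ with h | h
    · have := hball h
      have : (0 : ℝ) ≤ k * dist z w := by positivity
      linarith
    · have h1 : f z ≤ m * δ := (div_le_iff₀ hδ).1 hm
      have h2 : (m : ℝ) * δ ≤ k * dist z w := by
        rw [dist_comm z w]; gcongr
      have := h0 w
      linarith

/-- If the closed set `T ⊆ Z × ℝ` consists of the points on and above the graph of `f`, then `f` is
lower semicontinuous. -/
theorem lowerSemicontinuous_of_isClosed_iff {Z : Type*} [TopologicalSpace Z] {T : Set (Z × ℝ)}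
    (hT : IsClosed T) {f : Z → ℝ} (hf : ∀ z a, f z ≤ a ↔ (z, a) ∈ T) :
    LowerSemicontinuous f := by
  rw [lowerSemicontinuous_iff_isClosed_preimage]
  intro a
  have : f ⁻¹' Iic a = (fun z => (z, a)) ⁻¹' T := by ext z; simp [hf]
  rw [this]
  exact hT.preimage (by fun_prop)

/-! ### Covers by a fixed number of balls, and closedness at one scale -/

theorem isCover_toNNReal_iff {X : Type*} [PseudoMetricSpace X] {r : ℝ} (hr : 0 ≤ r)
    {A C : Set X} :
    Metric.IsCover r.toNNReal A C ↔ ∀ y ∈ A, ∃ c ∈ C, dist y c ≤ r := by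
  have : ∀ y c : X, edist y c ≤ (r.toNNReal : ℝ≥0∞) ↔ dist y c ≤ r := fun y c => by
    rw [edist_dist]; exact ENNReal.ofReal_le_ofReal_iff hr
  simp [Metric.IsCover, SetRel.IsCover, this]

/-- Padding to exactly `k` centres makes a cover a point of `Fin k → X`, which is compact when `X`
is. -/
theorem exists_fin_cover_of_encard_le {X : Type*} [Nonempty X] {C : Set X} {k : ℕ}
    (h : C.encard ≤ k) : ∃ c : Fin k → X, C ⊆ range c := by
  have hfin : C.Finite := finite_of_encard_le_coe h
  have := hfin.fintype
  have hcard : Fintype.card C ≤ Fintype.card (Fin k) := by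
    rw [encard_eq_coe_toFinset_card, Nat.cast_le, toFinset_card] at h
    simpa using h
  obtain ⟨e⟩ := Function.Embedding.nonempty_of_card_le hcard
  refine ⟨Function.extend e (↑) fun _ => Classical.arbitrary X, fun x hx => ⟨e ⟨x, hx⟩, ?_⟩⟩
  rw [e.injective.extend_apply]

theorem toENNReal_le_ofReal_iff {N : ℕ∞} {L : ℝ} (hL : 0 ≤ L) :
    (N : ℝ≥0∞) ≤ ENNReal.ofReal L ↔ N ≤ (⌊L⌋₊ : ℕ) := by
  induction N using ENat.recTopCoe with
  | top => simp
  | coe n =>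
    rw [Nat.cast_le, Nat.le_floor_iff hL, ENat.toENNReal_coe, ← ENNReal.ofReal_natCast,
      ENNReal.ofReal_le_ofReal_iff hL]

theorem externalCoveringNumber_le_ofReal_iff {X : Type*} [PseudoMetricSpace X] [Nonempty X]
    {r L : ℝ} (hr : 0 ≤ r) (hL : 0 ≤ L) {A : Set X} :
    ((Metric.externalCoveringNumber r.toNNReal A : ℕ∞) : ℝ≥0∞) ≤ ENNReal.ofReal L ↔
      ∃ c : Fin ⌊L⌋₊ → X, ∀ y ∈ A, ∃ i, dist y (c i) ≤ r := by
  rw [toENNReal_le_ofReal_iff hL]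
  constructor
  · intro h
    have h' : Metric.externalCoveringNumber r.toNNReal A < (⌊L⌋₊ : ℕ∞) + 1 :=
      (ENat.lt_add_one_iff (ENat.natCast_ne_top _)).2 h |>.trans_le le_rfl
    simp only [Metric.externalCoveringNumber, iInf_lt_iff] at h'
    obtain ⟨C, hC, hcard⟩ := h'
    obtain ⟨c, hc⟩ := exists_fin_cover_of_encard_le
      ((ENat.lt_add_one_iff (ENat.natCast_ne_top _)).1 hcard)
    refine ⟨c, fun y hy => ?_⟩
    obtain ⟨z, hz, hyz⟩ := (isCover_toNNReal_iff hr).1 hC y hy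
    obtain ⟨i, rfl⟩ := hc hz
    exact ⟨i, hyz⟩
  · rintro ⟨c, hc⟩
    have hcov : Metric.IsCover r.toNNReal A (range c) := (isCover_toNNReal_iff hr).2 fun y hy => by
      simpa using hc y hy
    refine hcov.externalCoveringNumber_le_encard.trans ?_
    rw [← image_univ]
    refine (encard_image_le _ _).trans ?_
    simp

/-- A point of a compact set is the limit of points of compact sets converging to it. -/
theorem TopologicalSpace.NonemptyCompacts.exists_tendsto_of_mem {X : Type*} [MetricSpace X]
    {F : NonemptyCompacts X} {x : X} (hx : x ∈ F) :
    ∃ s : NonemptyCompacts X → X, (∀ E, s E ∈ E) ∧ Tendsto s (𝓝 F) (𝓝 x) := by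
  choose s hs hdist using fun E : NonemptyCompacts X =>
    E.isCompact.exists_infDist_eq_dist E.nonempty x
  refine ⟨s, hs, tendsto_iff_dist_tendsto_zero.2 ?_⟩
  have h := (Metric.lipschitz_infDist_set x).continuous.tendsto F
  rw [Metric.infDist_zero_of_mem hx] at h
  exact h.congr fun E => by rw [hdist E, dist_comm]

/-- The pairs `((F, θ), α)` for which the covering bound holds with constant `1` at scale `R`. -/
theorem isClosed_setOf_externalCoveringNumber_le {X : Type*} [MetricSpace X] [CompactSpace X]
    {R : ℝ} (hR : 0 < R) :
    IsClosed {q : (NonemptyCompacts X × Ioo (0 : ℝ) 1) × ℝ | ∀ x ∈ q.1.1,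
      ((Metric.externalCoveringNumber (R ^ (1 / (q.1.2 : ℝ))).toNNReal
        (Metric.ball x R ∩ q.1.1) : ℕ∞) : ℝ≥0∞) ≤
          ENNReal.ofReal ((R / R ^ (1 / (q.1.2 : ℝ))) ^ q.2)} := by
  refine isClosed_iff_ultrafilter.2 fun q U hUq hU x hx => ?_
  have : Nonempty X := ⟨x⟩
  have hrpos : ∀ t : ℝ, 0 < R ^ t := fun t => Real.rpow_pos_of_pos hR t
  set r : (NonemptyCompacts X × Ioo (0 : ℝ) 1) × ℝ → ℝ := fun q => R ^ (1 / (q.1.2 : ℝ)) with hr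
  have hr0 : ∀ q, 0 < r q := fun q => hrpos _
  have hrc : Continuous r := by
    refine Continuous.rpow continuous_const ?_ fun _ => Or.inl hR.ne'
    exact continuous_const.div (by fun_prop) fun q => q.1.2.2.1.ne'
  have hLpos : ∀ q, 0 < (R / r q) ^ q.2 := fun q => Real.rpow_pos_of_pos (div_pos hR (hr0 q)) _
  have hLc : Continuous fun q => (R / r q) ^ q.2 :=
    (continuous_const.div hrc fun q => (hr0 q).ne').rpow continuous_snd
      fun q => Or.inl (div_pos hR (hr0 q)).ne'
  have hfst : Tendsto (fun q : (NonemptyCompacts X × Ioo (0 : ℝ) 1) × ℝ => q.1.1) U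
      (𝓝 q.1.1) := ((by fun_prop : Continuous fun q :
        (NonemptyCompacts X × Ioo (0 : ℝ) 1) × ℝ => q.1.1).tendsto q).mono_left hUq
  obtain ⟨s, hs, hsx⟩ := NonemptyCompacts.exists_tendsto_of_mem hx
  have hsx' := hsx.comp hfst
  set k := ⌊(R / r q) ^ q.2⌋₊ with hk
  -- The floor is upper semicontinuous, so near `q` at most `k` balls are allowed, with the same
  -- `k`.
  have hcov : ∀ᶠ q' in (U : Filter _), ∃ c : Fin k → X,
      ∀ y ∈ Metric.ball (s q'.1.1) R ∩ q'.1.1, ∃ i, dist y (c i) ≤ r q' := by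
    have hlt : ∀ᶠ q' in (U : Filter _), (R / r q') ^ q'.2 < k + 1 :=
      hUq ((hLc.tendsto q).eventually_lt_const (Nat.lt_floor_add_one _))
    filter_upwards [hlt, hU] with q' hq' hmem
    have h1 := (toENNReal_le_ofReal_iff (hLpos q').le).1 (hmem _ (hs q'.1.1))
    have h2 : ⌊(R / r q') ^ q'.2⌋₊ ≤ k := Nat.lt_succ_iff.1 <|
      (Nat.floor_lt (hLpos q').le).2 (by simpa using hq')
    have h3 := (toENNReal_le_ofReal_iff (Nat.cast_nonneg k)).2
      ((h1.trans (Nat.cast_le.2 h2)).trans_eq (by rw [Nat.floor_natCast (R := ℝ)]))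
    have h4 := (externalCoveringNumber_le_ofReal_iff (hr0 q').le (Nat.cast_nonneg k)).1 h3
    rwa [Nat.floor_natCast] at h4
  choose! c hc using fun q' (h : ∃ c : Fin k → X,
      ∀ y ∈ Metric.ball (s q'.1.1) R ∩ q'.1.1, ∃ i, dist y (c i) ≤ r q') => h
  have hc' : ∀ᶠ q' in (U : Filter _),
      ∀ y ∈ Metric.ball (s q'.1.1) R ∩ q'.1.1, ∃ i, dist y (c q' i) ≤ r q' :=
    hcov.mono fun q' h => hc q' h
  obtain ⟨c₀, -, hc₀⟩ := isCompact_univ.ultrafilter_le_nhds (U.map c) (by simp)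
  have hc₀' : Tendsto c U (𝓝 c₀) := hc₀
  refine (externalCoveringNumber_le_ofReal_iff (hr0 q).le (hLpos q).le).2 ⟨c₀, ?_⟩
  rintro y ⟨hyR, hyF⟩
  -- A point of the open ball missed by the limit cover is a limit of points of the nearby sets;
  -- these lie in the nearby open balls and strictly outside the nearby closed covering balls.
  by_contra! hfar
  obtain ⟨t, ht, hty⟩ := NonemptyCompacts.exists_tendsto_of_mem hyF
  have hty' := hty.comp hfst
  have hnear := (hty'.dist hsx').eventually_lt_const hyR
  have hfar' : ∀ᶠ q' in (U : Filter _), ∀ i, r q' < dist (t q'.1.1) (c q' i) :=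
    eventually_all.2 fun i => ((hrc.tendsto q).mono_left hUq).eventually_lt
      (hty'.dist ((tendsto_pi_nhds.1 hc₀') i)) (hfar i)
  obtain ⟨q', h1, h2, h3⟩ := (hnear.and (hfar'.and hc')).exists
  obtain ⟨i, hi⟩ := h3 _ ⟨h1, ht _⟩
  exact (h2 i).not_ge hi

/-! ### Absorbing the constant; lower semicontinuous approximations -/

theorem div_rpow_one_div {R θ : ℝ} (hR : 0 < R) : R / R ^ (1 / θ) = R ^ (-(1 / θ - 1)) := by
  rw [neg_sub, Real.rpow_sub hR, Real.rpow_one]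

theorem one_div_sub_one_pos {θ : ℝ} (hθ : θ ∈ Ioo (0 : ℝ) 1) : 0 < 1 / θ - 1 :=
  sub_pos.2 (one_lt_one_div hθ.1 hθ.2)

theorem one_le_div_rpow {R θ : ℝ} (hR : 0 < R) (hR1 : R ≤ 1) (hθ : θ ∈ Ioo (0 : ℝ) 1) :
    1 ≤ R / R ^ (1 / θ) := by
  rw [div_rpow_one_div hR]
  exact Real.one_le_rpow_of_pos_of_le_one_of_nonpos hR hR1
    (neg_nonpos.2 (one_div_sub_one_pos hθ).le)

theorem tendsto_div_rpow_rpow {θ δ : ℝ} (hθ : θ ∈ Ioo (0 : ℝ) 1) (hδ : 0 < δ) :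
    Tendsto (fun R : ℝ => (R / R ^ (1 / θ)) ^ δ) (𝓝[>] 0) atTop := by
  refine (tendsto_rpow_atTop hδ).comp ?_
  refine (tendsto_rpow_neg_nhdsGT_zero (neg_neg_of_pos (one_div_sub_one_pos hθ))).congr' ?_
  filter_upwards [self_mem_nhdsWithin] with R hR
  rw [div_rpow_one_div hR]

theorem exists_le_div_rpow_rpow {θ δ : ℝ} (hθ : θ ∈ Ioo (0 : ℝ) 1) (hδ : 0 < δ) (C : ℝ) :
    ∃ ρ > (0 : ℝ), ∀ R, 0 < R → R ≤ ρ → C ≤ (R / R ^ (1 / θ)) ^ δ := by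
  obtain ⟨u, hu, h⟩ := mem_nhdsGT_iff_exists_Ioc_subset.1
    ((tendsto_div_rpow_rpow hθ hδ).eventually_ge_atTop C)
  exact ⟨u, hu, fun R h1 h2 => h ⟨h1, h2⟩⟩

/-- At least one ball is always needed, whereas for `α < 0` the bound tends to 0; the factor 2 below
pushes it down to `1 / 2`. -/
theorem AssouadSpectrumBound.nonneg {X : Type*} [MetricSpace X] {F : Set X} (hF : F.Nonempty)
    {θ α : ℝ} (hθ : θ ∈ Ioo (0 : ℝ) 1) (h : AssouadSpectrumBound F θ α) : 0 ≤ α := by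
  by_contra! hα
  obtain ⟨C, hC, ρ, hρ, h⟩ := h
  obtain ⟨x, hx⟩ := hF
  obtain ⟨ρ', hρ', hbig⟩ := exists_le_div_rpow_rpow hθ (neg_pos.2 hα) (2 * C)
  set R := min ρ ρ'
  have hR : 0 < R := lt_min hρ hρ'
  have h1 := h R hR (min_le_left _ _) x hx
  have hq : 0 < R / R ^ (1 / θ) := div_pos hR (Real.rpow_pos_of_pos hR _)
  have hN : 0 < Metric.externalCoveringNumber (R ^ (1 / θ)).toNNReal (Metric.ball x R ∩ F) :=
    Metric.externalCoveringNumber_pos_iff.2 ⟨x, Metric.mem_ball_self hR, hx⟩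
  rw [toENNReal_le_ofReal_iff (by positivity)] at h1
  have h2 : 0 < ⌊C * (R / R ^ (1 / θ)) ^ α⌋₊ := by exact_mod_cast hN.trans_le h1
  have h3 := Nat.floor_pos.1 h2
  have h4 := hbig R hR (min_le_right _ _)
  rw [Real.rpow_neg hq.le] at h4
  have hp : 0 < (R / R ^ (1 / θ)) ^ α := Real.rpow_pos_of_pos hq α
  have h5 := mul_le_mul_of_nonneg_right h4 hp.le
  rw [inv_mul_cancel₀ hp.ne'] at h5
  nlinarith

theorem assouadSpectrum_nonneg {X : Type*} [MetricSpace X] {F : Set X} (hF : F.Nonempty)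
    {θ : ℝ} (hθ : θ ∈ Ioo (0 : ℝ) 1) : 0 ≤ assouadSpectrum F θ :=
  le_iInf₂ fun _ h => EReal.coe_nonneg.2 (h.nonneg hF hθ)

theorem assouadSpectrum_le_of_bound {X : Type*} [MetricSpace X] {F : Set X} {θ α : ℝ}
    (h : AssouadSpectrumBound F θ α) : assouadSpectrum F θ ≤ α :=
  iInf₂_le α h

/-- The pairs `((F, θ), α)` for which the covering bound holds with constant `1` at all scales
`R ≤ 1 / (n + 1)`. -/
def uniformBoundSet (X : Type*) [MetricSpace X] (n : ℕ) :
    Set ((NonemptyCompacts X × Ioo (0 : ℝ) 1) × ℝ) :=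
  {q | ∀ R : ℝ, 0 < R → R ≤ 1 / (n + 1) → ∀ x ∈ q.1.1,
    ((Metric.externalCoveringNumber (R ^ (1 / (q.1.2 : ℝ))).toNNReal
      (Metric.ball x R ∩ q.1.1) : ℕ∞) : ℝ≥0∞) ≤
        ENNReal.ofReal ((R / R ^ (1 / (q.1.2 : ℝ))) ^ q.2)}

theorem isClosed_uniformBoundSet (X : Type*) [MetricSpace X] [CompactSpace X] (n : ℕ) :
    IsClosed (uniformBoundSet X n) := by
  simp only [uniformBoundSet, ofPred_forall]
  refine isClosed_iInter fun R => isClosed_iInter fun hR => isClosed_iInter fun _ => ?_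
  simpa only [ofPred_forall] using isClosed_setOf_externalCoveringNumber_le (X := X) hR

theorem uniformBoundSet_mono {X : Type*} [MetricSpace X] {n : ℕ}
    {p : NonemptyCompacts X × Ioo (0 : ℝ) 1} {α β : ℝ} (h : (p, α) ∈ uniformBoundSet X n)
    (hαβ : α ≤ β) : (p, β) ∈ uniformBoundSet X n := by
  intro R hR hRn x hx
  refine (h R hR hRn x hx).trans (ENNReal.ofReal_le_ofReal ?_)
  refine Real.rpow_le_rpow_of_exponent_le (one_le_div_rpow hR (hRn.trans ?_) p.2.2) hαβ
  exact (div_le_one (by positivity)).2 (by linarith [n.cast_nonneg (α := ℝ)])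

theorem assouadSpectrumBound_of_mem_uniformBoundSet {X : Type*} [MetricSpace X] {n : ℕ}
    {p : NonemptyCompacts X × Ioo (0 : ℝ) 1} {α : ℝ} (h : (p, α) ∈ uniformBoundSet X n) :
    AssouadSpectrumBound (p.1 : Set X) p.2 α :=
  ⟨1, one_pos, 1 / (n + 1), by positivity, fun R hR hRn x hx => by
    simpa only [one_mul] using h R hR hRn x hx⟩

theorem AssouadSpectrumBound.eventually_mem_uniformBoundSet {X : Type*} [MetricSpace X]
    {p : NonemptyCompacts X × Ioo (0 : ℝ) 1} {α β : ℝ}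
    (h : AssouadSpectrumBound (p.1 : Set X) p.2 α) (hαβ : α < β) :
    ∀ᶠ n in atTop, (p, β) ∈ uniformBoundSet X n := by
  obtain ⟨C, hC, ρ, hρ, h⟩ := h
  obtain ⟨ρ', hρ', hbig⟩ := exists_le_div_rpow_rpow p.2.2 (sub_pos.2 hαβ) C
  have hlim := tendsto_one_div_add_atTop_nhds_zero_nat (𝕜 := ℝ)
  filter_upwards [hlim.eventually_lt_const (lt_min hρ hρ')] with n hn R hR hRn x hx
  have hlt := hRn.trans_lt hn
  refine (h R hR (hlt.trans_le (min_le_left _ _)).le x hx).trans (ENNReal.ofReal_le_ofReal ?_)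
  have hq : 0 < R / R ^ (1 / (p.2 : ℝ)) := div_pos hR (Real.rpow_pos_of_pos hR _)
  calc C * (R / R ^ (1 / (p.2 : ℝ))) ^ α
      ≤ (R / R ^ (1 / (p.2 : ℝ))) ^ (β - α) * (R / R ^ (1 / (p.2 : ℝ))) ^ α := by
        gcongr
        exact hbig R hR (hlt.trans_le (min_le_right _ _)).le
    _ = _ := by rw [← Real.rpow_add hq, sub_add_cancel]

/-- The exponents in `[0, ∞)` that are at least `n` or admissible for `(F, θ)` with constant `1` at
all scales `R ≤ 1 / (n + 1)`. -/
def truncatedBoundSet (X : Type*) [MetricSpace X] (n : ℕ) :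
    Set ((NonemptyCompacts X × Ioo (0 : ℝ) 1) × ℝ) :=
  {q | 0 ≤ q.2} ∩ ({q | (n : ℝ) ≤ q.2} ∪ uniformBoundSet X n)

/-- The lower semicontinuous approximations of the Assouad spectrum. -/
noncomputable def truncatedExponent (X : Type*) [MetricSpace X] (n : ℕ)
    (p : NonemptyCompacts X × Ioo (0 : ℝ) 1) : ℝ :=
  sInf {α | (p, α) ∈ truncatedBoundSet X n}

theorem isClosed_truncatedBoundSet (X : Type*) [MetricSpace X] [CompactSpace X] (n : ℕ) :
    IsClosed (truncatedBoundSet X n) :=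
  (isClosed_le continuous_const continuous_snd).inter
    ((isClosed_le continuous_const continuous_snd).union (isClosed_uniformBoundSet X n))

theorem truncatedExponent_le_iff {X : Type*} [MetricSpace X] [CompactSpace X] (n : ℕ)
    (p : NonemptyCompacts X × Ioo (0 : ℝ) 1) (a : ℝ) :
    truncatedExponent X n p ≤ a ↔ (p, a) ∈ truncatedBoundSet X n := by
  have hbdd : BddBelow {α | (p, α) ∈ truncatedBoundSet X n} := ⟨0, fun α h => h.1⟩
  -- The truncation at `n` avoids the default value 0 of `sInf ∅`, which would be wrong when no
  -- exponent is admissible.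
  have hne : {α | (p, α) ∈ truncatedBoundSet X n}.Nonempty :=
    ⟨n, mem_ofPred.2 (Nat.cast_nonneg n), Or.inl (mem_ofPred.2 le_rfl)⟩
  have hcl : IsClosed {α | (p, α) ∈ truncatedBoundSet X n} :=
    (isClosed_truncatedBoundSet X n).preimage (by fun_prop : Continuous fun α : ℝ => (p, α))
  refine ⟨fun h => ?_, fun h => csInf_le hbdd h⟩
  obtain ⟨h0, h1⟩ := hcl.csInf_mem hne hbdd
  exact ⟨le_trans (show (0 : ℝ) ≤ _ from h0) h, h1.imp
    (fun h1 => le_trans (show (n : ℝ) ≤ _ from h1) h) fun h1 => uniformBoundSet_mono h1 h⟩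

theorem isBaireClass_one_truncatedExponent (X : Type*) [MetricSpace X] [CompactSpace X] (n : ℕ) :
    IsBaireClass 1 (truncatedExponent X n) :=
  (lowerSemicontinuous_of_isClosed_iff (isClosed_truncatedBoundSet X n)
    (truncatedExponent_le_iff n)).isBaireClass_one fun p =>
      ((truncatedExponent_le_iff n p _).1 le_rfl).1

theorem tendsto_truncatedExponent {X : Type*} [MetricSpace X] [CompactSpace X]
    (p : NonemptyCompacts X × Ioo (0 : ℝ) 1) :
    Tendsto (fun n => (truncatedExponent X n p : EReal)) atTop (𝓝 (assouadSpectrumMap X p)) := by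
  refine tendsto_order.2 ⟨fun a ha => ?_, fun a ha => ?_⟩
  · obtain ⟨α, haα, hα⟩ := EReal.lt_iff_exists_real_btwn.1 ha
    obtain ⟨m, hm⟩ := exists_nat_gt α
    filter_upwards [eventually_ge_atTop m] with n hn
    refine haα.trans (EReal.coe_lt_coe_iff.2 ?_)
    by_contra! hle
    rcases ((truncatedExponent_le_iff n p α).1 hle).2 with h | h
    · have h' : (n : ℝ) ≤ α := h
      have : (m : ℝ) ≤ n := Nat.cast_le.2 hn
      linarith
    · exact hα.not_ge (assouadSpectrum_le_of_bound (assouadSpectrumBound_of_mem_uniformBoundSet h))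
  · obtain ⟨β, hβ, hβa⟩ := EReal.lt_iff_exists_real_btwn.1 ha
    simp only [assouadSpectrumMap, assouadSpectrum, iInf_lt_iff] at hβ
    obtain ⟨α, hα, hαβ⟩ := hβ
    have hαβ' : α < β := EReal.coe_lt_coe_iff.1 hαβ
    filter_upwards [hα.eventually_mem_uniformBoundSet hαβ'] with n hn
    refine lt_of_le_of_lt (EReal.coe_le_coe_iff.2 ((truncatedExponent_le_iff n p β).2 ⟨?_, ?_⟩)) hβa
    · exact (hα.nonneg p.1.nonempty p.2.2).trans hαβ'.le
    · exact Or.inr hn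

theorem isBaireClass_two_assouadSpectrumMap (X : Type*) [MetricSpace X] [CompactSpace X] :
    IsBaireClass 2 (assouadSpectrumMap X) :=
  ⟨fun n p => (truncatedExponent X n p : EReal), fun n =>
    (isBaireClass_one_truncatedExponent X n).continuous_comp continuous_coe_real_ereal,
    tendsto_truncatedExponent⟩

theorem isBaireClass_two_of_coe_eq_assouadSpectrumMap {X : Type*} [MetricSpace X] [CompactSpace X]
    {f : NonemptyCompacts X × Ioo (0 : ℝ) 1 → ℝ}
    (hf : ∀ p, (f p : EReal) = assouadSpectrumMap X p) : IsBaireClass 2 f :=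
  ⟨truncatedExponent X, isBaireClass_one_truncatedExponent X, fun p =>
    EReal.tendsto_coe.1 (hf p ▸ tendsto_truncatedExponent p)⟩

/-! ### Failure of class 1: Baire category and progressions in the unit interval -/

theorem not_isBaireClass_one_of_frequently {f : (ℕ → Bool) → EReal}
    (hfin : ∀ ω : ℕ → Bool, {n | ω n = true}.Finite → f ω ≤ 0)
    (hinf : ∀ ω : ℕ → Bool, {n | ω n = true}.Infinite → 1 ≤ f ω) : ¬ IsBaireClass 1 f := by
  rintro ⟨g, hg, hlim⟩
  have hgc : ∀ k, Continuous (g k) := hg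
  have h01 : ((1 / 2 : ℝ) : EReal) < 1 := by exact_mod_cast (by norm_num : (1 / 2 : ℝ) < 1)
  have h00 : (0 : EReal) < ((1 / 2 : ℝ) : EReal) := by
    exact_mod_cast (by norm_num : (0 : ℝ) < 1 / 2)
  have happrox : ∀ (ω : ℕ → Bool) (m : ℕ) (b : Bool), ∃ ω' : ℕ → Bool, (∀ n < m, ω' n = ω n) ∧
      ∀ n ≥ m, ω' n = b := fun ω m b =>
    ⟨fun n => if n < m then ω n else b, fun n hn => by simp [hn], fun n hn => by simp [hn.not_gt]⟩
  have hdense : ∀ (b : Bool) (s : Set (ℕ → Bool)),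
      (∀ ω : ℕ → Bool, (∃ m, ∀ n ≥ m, ω n = b) → ω ∈ s) → Dense s := by
    intro b s hs ω
    choose u hu hub using fun m => happrox ω m b
    refine mem_closure_of_tendsto (b := atTop) (f := u) ?_
      (Eventually.of_forall fun m => hs _ ⟨m, hub m⟩)
    refine tendsto_pi_nhds.2 fun n => tendsto_const_nhds.congr' ?_
    filter_upwards [eventually_gt_atTop n] with m hm
    exact (hu m n hm).symm
  -- On `s` the limit is at least 1; on `t` infinitely many `g k` are below `1 / 2`. Both are dense
  -- Gδ sets, so they meet.
  let s : Set (ℕ → Bool) := ⋂ m, ⋃ n ≥ m, {ω | ω n = true}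
  let t : Set (ℕ → Bool) := ⋂ m, ⋃ k ≥ m, {ω | g k ω < ((1 / 2 : ℝ) : EReal)}
  have hs : IsGδ s := .iInter_of_isOpen fun m => isOpen_biUnion fun n _ =>
    (isOpen_discrete ({true} : Set Bool)).preimage
      (continuous_apply n : Continuous fun ω : ℕ → Bool => ω n)
  have ht : IsGδ t := .iInter_of_isOpen fun m => isOpen_biUnion fun k _ =>
    isOpen_lt (hgc k) continuous_const
  have hsd : Dense s := hdense true s fun ω ⟨m, hm⟩ => by
    simp only [s, mem_iInter, mem_iUnion]
    exact fun i => ⟨max i m, le_max_left _ _, hm _ (le_max_right _ _)⟩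
  have htd : Dense t := hdense false t fun ω ⟨m, hm⟩ => by
    have hω : f ω ≤ 0 := hfin ω <| (finite_Iio m).subset fun n hn => by
      by_contra h
      simp [hm n (not_lt.1 h)] at hn
    simp only [t, mem_iInter, mem_iUnion]
    intro i
    obtain ⟨k, hk, hik⟩ := (((hlim ω).eventually_lt_const (hω.trans_lt h00)).and
      (eventually_ge_atTop i)).exists
    exact ⟨k, hik, hk⟩
  obtain ⟨ω, h1, h2⟩ := (hsd.inter_of_Gδ hs ht htd).nonempty
  simp only [s, t, mem_iInter, mem_iUnion] at h1 h2
  have hω : 1 ≤ f ω := hinf ω <| infinite_of_not_bddAbove fun ⟨b, hb⟩ => by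
    obtain ⟨n, hn, hn'⟩ := h1 (b + 1)
    have := hb hn'
    omega
  obtain ⟨m, hm⟩ := eventually_atTop.1 ((hlim ω).eventually_const_lt (h01.trans_le hω))
  obtain ⟨k, hk, hk'⟩ := h2 m
  exact lt_asymm (hm k hk) hk'

theorem assouadSpectrumBound_zero_of_finite {X : Type*} [MetricSpace X] {F : Set X}
    (hF : F.Finite) (θ : ℝ) : AssouadSpectrumBound F θ 0 := by
  refine ⟨F.ncard + 1, by positivity, 1, one_pos, fun R hR _ x _ => ?_⟩
  rw [Real.rpow_zero, mul_one, toENNReal_le_ofReal_iff (by positivity)]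
  refine (Metric.externalCoveringNumber_le_encard_self _).trans
    ((encard_le_encard inter_subset_right).trans ?_)
  rw [← hF.cast_ncard_eq, Nat.cast_le]
  exact Nat.le_floor (by linarith)

theorem assouadSpectrumBound_one_unitInterval (F : Set (Icc (0 : ℝ) 1)) {θ : ℝ}
    (hθ : θ ∈ Ioo (0 : ℝ) 1) : AssouadSpectrumBound F θ 1 := by
  -- The multiples of `r` needed number at most `2 * (R / r) + 2`, and `1 ≤ R / r`.
  refine ⟨4, by norm_num, 1, one_pos, fun R hR hR1 x _ => ?_⟩
  set r := R ^ (1 / θ)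
  have hr : 0 < r := Real.rpow_pos_of_pos hR _
  have hq : 1 ≤ R / r := one_le_div_rpow hR hR1 hθ
  rw [Real.rpow_one, toENNReal_le_ofReal_iff (by positivity)]
  set a := ⌊(x - R) / r⌋
  set b := ⌊(x + R) / r⌋
  have hcov : Metric.IsCover r.toNNReal (Metric.ball x R ∩ F)
      ((Finset.Icc a b).image fun j : ℤ => projIcc (0 : ℝ) 1 zero_le_one (j * r) :
        Finset (Icc (0 : ℝ) 1)) := by
    refine (isCover_toNNReal_iff hr.le).2 fun y ⟨hy, _⟩ => ?_
    rw [Metric.mem_ball, Subtype.dist_eq, Real.dist_eq, abs_lt] at hy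
    have hfl : (⌊(y : ℝ) / r⌋ : ℝ) * r ≤ y := (le_div_iff₀ hr).1 (Int.floor_le _)
    have hfl' : (y : ℝ) < (⌊(y : ℝ) / r⌋ + 1) * r := (div_lt_iff₀ hr).1 (Int.lt_floor_add_one _)
    have h0 : (0 : ℝ) ≤ (⌊(y : ℝ) / r⌋ : ℝ) * r :=
      mul_nonneg (Int.cast_nonneg (Int.floor_nonneg.2 (div_nonneg y.2.1 hr.le))) hr.le
    refine ⟨_, Finset.mem_coe.2 (Finset.mem_image_of_mem _ (Finset.mem_Icc.2
      (⟨Int.floor_mono ?_, Int.floor_mono ?_⟩ : a ≤ ⌊(y : ℝ) / r⌋ ∧ ⌊(y : ℝ) / r⌋ ≤ b))), ?_⟩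
    · gcongr; linarith
    · gcongr; linarith
    · rw [projIcc_of_mem zero_le_one ⟨h0, hfl.trans y.2.2⟩, Subtype.dist_eq, Real.dist_eq, abs_le]
      constructor <;> linarith
  refine hcov.externalCoveringNumber_le_encard.trans ?_
  rw [encard_coe_eq_coe_finsetCard, Nat.cast_le]
  refine Finset.card_image_le.trans (Nat.le_floor ?_)
  have hab : a ≤ b := Int.floor_mono (by gcongr; linarith)
  have hcard : (((Finset.Icc a b).card : ℤ) : ℝ) = b + 1 - a := by
    rw [Int.card_Icc, Int.toNat_of_nonneg (by omega)]
    push_cast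
    rfl
  rw [Int.cast_natCast] at hcard
  have hb : (b : ℝ) ≤ (x + R) / r := Int.floor_le _
  have ha : (x - R) / r < a + 1 := Int.lt_floor_add_one _
  have : (x + R) / r - (x - R) / r = 2 * (R / r) := by ring
  rw [hcard]
  linarith

/-- The set that contains `0` and, for every `n` with `ω n = true`, the points `j / (3 (n + 1)²)`
with `j ≤ n`. -/
def progressionSet (ω : ℕ → Bool) : Set (Icc (0 : ℝ) 1) :=
  {y | (y : ℝ) = 0 ∨ ∃ n, ω n = true ∧ ∃ j ≤ n, (y : ℝ) = j / (3 * (n + 1) ^ 2)}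

theorem zero_mem_progressionSet (ω : ℕ → Bool) : (0 : Icc (0 : ℝ) 1) ∈ progressionSet ω :=
  Or.inl rfl

theorem progression_lt {j n : ℕ} (h : j ≤ n) :
    (j : ℝ) / (3 * (n + 1) ^ 2) < 1 / (3 * (n + 1)) := by
  have : (j : ℝ) ≤ n := Nat.cast_le.2 h
  rw [div_lt_div_iff₀ (by positivity) (by positivity)]
  nlinarith [(n.cast_nonneg : (0 : ℝ) ≤ n)]

theorem finite_progressionSet {ω : ℕ → Bool} (hω : {n | ω n = true}.Finite) :
    (progressionSet ω).Finite := by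
  have h : (⋃ n ∈ {n | ω n = true}, (fun j : ℕ => (j : ℝ) / (3 * ((n : ℝ) + 1) ^ 2)) ''
      Iic n).Finite := hω.biUnion fun n _ => (finite_Iic n).image _
  refine Finite.of_finite_image (f := ((↑) : Icc (0 : ℝ) 1 → ℝ)) ((h.insert 0).subset ?_)
    Subtype.val_injective.injOn
  rintro _ ⟨y, h | ⟨n, hn, j, hj, h⟩, rfl⟩
  · exact Or.inl h
  · exact Or.inr (mem_biUnion hn ⟨j, hj, h.symm⟩)

/-- The closure of `progressionSet ω` as a nonempty compact set. -/
def progressionCompact (ω : ℕ → Bool) : NonemptyCompacts (Icc (0 : ℝ) 1) where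
  carrier := closure (progressionSet ω)
  isCompact' := isClosed_closure.isCompact
  nonempty' := ⟨0, subset_closure (zero_mem_progressionSet ω)⟩

/-- Progressions with index at least `m` lie so close to `0` that the common point `0` can replace
them. -/
theorem exists_progressionSet_dist_le {ω ω' : ℕ → Bool} {m : ℕ} (h : ∀ n < m, ω n = ω' n)
    {y : Icc (0 : ℝ) 1} (hy : y ∈ progressionSet ω) :
    ∃ z ∈ progressionSet ω', dist y z ≤ 1 / (m + 1) := by
  have hpos : (0 : ℝ) ≤ 1 / (m + 1) := by positivity
  rcases hy with hy | ⟨n, hn, j, hj, hy⟩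
  · exact ⟨y, Or.inl hy, by simpa using hpos⟩
  rcases lt_or_ge n m with hnm | hnm
  · exact ⟨y, Or.inr ⟨n, h n hnm ▸ hn, j, hj, hy⟩, by simpa using hpos⟩
  · refine ⟨0, zero_mem_progressionSet ω', ?_⟩
    rw [Subtype.dist_eq, Real.dist_eq, hy, Icc.coe_zero, sub_zero, abs_of_nonneg (by positivity)]
    refine (progression_lt hj).le.trans ?_
    have : (m : ℝ) ≤ n := Nat.cast_le.2 hnm
    gcongr
    linarith [(n.cast_nonneg : (0 : ℝ) ≤ n)]

theorem continuous_progressionCompact : Continuous progressionCompact := by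
  refine continuous_iff_continuousAt.2 fun ω => EMetric.tendsto_nhds.2 fun ε hε => ?_
  have hlim : Tendsto (fun m : ℕ => ENNReal.ofReal (1 / ((m : ℝ) + 1))) atTop (𝓝 0) := by
    simpa using ENNReal.tendsto_ofReal (tendsto_one_div_add_atTop_nhds_zero_nat (𝕜 := ℝ))
  obtain ⟨m, hm⟩ := (hlim.eventually_lt_const hε).exists
  have hnear : ∀ᶠ ω' in 𝓝 ω, ∀ n ∈ Finset.range m, ω' n = ω n :=
    (Finset.eventually_all _).2 fun n _ =>
      (continuous_apply n).continuousAt.eventually_mem (by simp : {ω n} ∈ 𝓝 (ω n))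
  filter_upwards [hnear] with ω' hω'
  replace hω' : ∀ n < m, ω' n = ω n := fun n hn => hω' n (Finset.mem_range.2 hn)
  refine lt_of_le_of_lt ?_ hm
  change Metric.hausdorffEDist (closure (progressionSet ω')) (closure (progressionSet ω)) ≤ _
  rw [Metric.hausdorffEDist_closure]
  refine Metric.hausdorffEDist_le_of_mem_edist (fun y hy => ?_) (fun y hy => ?_)
  · obtain ⟨z, hz, hyz⟩ := exists_progressionSet_dist_le hω' hy
    exact ⟨z, hz, by rw [edist_dist]; exact ENNReal.ofReal_le_ofReal hyz⟩
  · obtain ⟨z, hz, hyz⟩ := exists_progressionSet_dist_le (fun n hn => (hω' n hn).symm) hy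
    exact ⟨z, hz, by rw [edist_dist]; exact ENNReal.ofReal_le_ofReal hyz⟩

/-- A cover at scale `R = 1 / (3 (n + 1))` needs at least `n + 1` balls of radius `R ^ 2`. -/
theorem succ_le_of_progression_cover {ω : ℕ → Bool} {n k : ℕ} (hn : ω n = true)
    {c : Fin k → Icc (0 : ℝ) 1}
    (hc : ∀ y ∈ Metric.ball 0 (1 / (3 * (n + 1) : ℝ)) ∩ closure (progressionSet ω),
      ∃ i, dist y (c i) ≤ (1 / (3 * (n + 1) : ℝ)) ^ 2) : n + 1 ≤ k := by
  have hlt : ∀ j : Fin (n + 1), (j : ℝ) / (3 * (n + 1) ^ 2) < 1 / (3 * (n + 1)) := fun j =>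
    progression_lt (Nat.lt_succ_iff.1 j.2)
  have hle1 : (1 : ℝ) / (3 * (n + 1)) ≤ 1 :=
    (div_le_one (by positivity)).2 (by linarith [(n.cast_nonneg : (0 : ℝ) ≤ n)])
  let y : Fin (n + 1) → Icc (0 : ℝ) 1 := fun j =>
    ⟨j / (3 * (n + 1) ^ 2), by positivity, (hlt j).le.trans hle1⟩
  have hy : ∀ j, ∃ i, dist (y j) (c i) ≤ (1 / (3 * (n + 1) : ℝ)) ^ 2 := fun j => by
    refine hc _ ⟨?_, subset_closure (Or.inr ⟨n, hn, j, Nat.lt_succ_iff.1 j.2, rfl⟩)⟩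
    rw [Metric.mem_ball, Subtype.dist_eq, Real.dist_eq, Icc.coe_zero, sub_zero,
      abs_of_nonneg (y j).2.1]
    exact hlt j
  choose e he using hy
  -- Two points in one ball are at most `2 / 9` of `1 / (n + 1) ^ 2` apart, less than the spacing,
  -- which is `1 / 3` of it.
  have hinj : Function.Injective e := fun j j' hjj => by
    have h1 := dist_triangle_right (y j) (y j') (c (e j))
    have h2 := he j'
    rw [← hjj] at h2
    have h3 : dist (y j) (y j') = |(j : ℝ) - j'| / (3 * (n + 1) ^ 2) := by
      rw [Subtype.dist_eq, Real.dist_eq, ← sub_div, abs_div,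
        abs_of_pos (by positivity : (0 : ℝ) < 3 * (n + 1) ^ 2)]
    have h4 : |(j : ℝ) - j'| / (3 * (n + 1) ^ 2) < 1 / (3 * (n + 1) ^ 2) := by
      rw [← h3]
      calc _ ≤ 2 * (1 / (3 * (n + 1) : ℝ)) ^ 2 := by linarith [he j]
        _ < _ := by
          rw [div_pow, one_pow, mul_one_div, div_lt_div_iff₀ (by positivity) (by positivity)]
          nlinarith [(by positivity : (0 : ℝ) < (n + 1 : ℝ) ^ 2)]
    rw [div_lt_div_iff_of_pos_right (by positivity)] at h4
    have h5 : |((j : ℕ) : ℤ) - (j' : ℕ)| < 1 := by exact_mod_cast h4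
    rw [Int.abs_lt_one_iff] at h5
    exact Fin.ext (by omega)
  simpa using Fintype.card_le_of_injective e hinj

theorem one_le_of_assouadSpectrumBound_progression {ω : ℕ → Bool}
    (hω : {n | ω n = true}.Infinite) {α : ℝ}
    (h : AssouadSpectrumBound (closure (progressionSet ω)) (1 / 2) α) : 1 ≤ α := by
  by_contra! hα
  obtain ⟨C, hC, ρ, hρ, h⟩ := h
  have hθ : (1 / 2 : ℝ) ∈ Ioo (0 : ℝ) 1 := by norm_num
  -- With `q = 3 * (n + 1)`, the cover gives `n + 1 ≤ C * q ^ α` and this choice gives `4 * C * q ^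
  -- α ≤ q`; so 4 beats the 3 in `q`.
  obtain ⟨ρ', hρ', hbig⟩ := exists_le_div_rpow_rpow hθ (sub_pos.2 hα) (4 * C)
  have hlim := tendsto_one_div_add_atTop_nhds_zero_nat (𝕜 := ℝ)
  obtain ⟨m, hm⟩ := eventually_atTop.1 (hlim.eventually_lt_const (lt_min hρ hρ'))
  obtain ⟨n, hn, hmn⟩ := hω.exists_gt m
  set R : ℝ := 1 / (3 * (n + 1)) with hR
  have hRpos : 0 < R := by positivity
  have hRlt : R < min ρ ρ' := by
    refine lt_of_le_of_lt ?_ (hm n hmn.le)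
    rw [hR]
    gcongr
    linarith [(n.cast_nonneg : (0 : ℝ) ≤ n)]
  have hpow : R ^ (1 / (1 / 2 : ℝ)) = R ^ 2 := by norm_num
  have hquot : R / R ^ (1 / (1 / 2 : ℝ)) = 3 * (n + 1) := by
    rw [hpow, hR]; field_simp
  have h1 := h R hRpos (hRlt.trans_le (min_le_left _ _)).le 0
    (subset_closure (zero_mem_progressionSet ω))
  have h2 := hbig R hRpos (hRlt.trans_le (min_le_right _ _)).le
  rw [hquot] at h1 h2
  have hq : (0 : ℝ) < 3 * (n + 1) := by positivity
  rw [hpow, externalCoveringNumber_le_ofReal_iff (by positivity) (by positivity)] at h1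
  obtain ⟨c, hc⟩ := h1
  have h3 := succ_le_of_progression_cover hn hc
  rw [Nat.le_floor_iff (by positivity)] at h3
  push_cast at h3
  have hp : (0 : ℝ) < (3 * (n + 1) : ℝ) ^ α := Real.rpow_pos_of_pos hq α
  have h4 : 4 * C * (3 * (n + 1) : ℝ) ^ α ≤ 3 * (n + 1) := by
    calc _ ≤ (3 * (n + 1) : ℝ) ^ (1 - α) * (3 * (n + 1) : ℝ) ^ α := by gcongr
      _ = _ := by rw [← Real.rpow_add hq, sub_add_cancel, Real.rpow_one]
  linarith [(n.cast_nonneg : (0 : ℝ) ≤ n)]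

theorem not_isBaireClass_one_assouadSpectrumMap_unitInterval :
    ¬ IsBaireClass 1 (assouadSpectrumMap (Icc (0 : ℝ) 1)) := by
  intro h
  have hcont : Continuous fun ω => (progressionCompact ω,
      (⟨1 / 2, by norm_num⟩ : Ioo (0 : ℝ) 1)) :=
    continuous_progressionCompact.prodMk continuous_const
  refine not_isBaireClass_one_of_frequently (fun ω hω => ?_) (fun ω hω => ?_)
    (h.comp_continuous hcont)
  · refine assouadSpectrum_le_of_bound (assouadSpectrumBound_zero_of_finite ?_ _)
    change (closure (progressionSet ω)).Finite
    rw [(finite_progressionSet hω).isClosed.closure_eq]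
    exact finite_progressionSet hω
  · exact le_iInf₂ fun α hα => by
      exact_mod_cast one_le_of_assouadSpectrumBound_progression hω hα

theorem coe_toReal_assouadSpectrumMap_unitInterval
    (p : NonemptyCompacts (Icc (0 : ℝ) 1) × Ioo (0 : ℝ) 1) :
    ((assouadSpectrumMap (Icc (0 : ℝ) 1) p).toReal : EReal) =
      assouadSpectrumMap (Icc (0 : ℝ) 1) p := by
  refine EReal.coe_toReal (ne_top_of_le_ne_top (EReal.coe_ne_top 1)
    (assouadSpectrum_le_of_bound (assouadSpectrumBound_one_unitInterval _ p.2.2)))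
    (ne_bot_of_le_ne_bot EReal.zero_ne_bot (assouadSpectrum_nonneg p.1.nonempty p.2.2))

theorem theorem5p1 :
    (∀ (X : Type*) [MetricSpace X] [CompactSpace X] [Nonempty X],
      (IsBaireClass 2 (assouadSpectrumMap X) ∧
        @Measurable _ _ (borel (NonemptyCompacts X × Ioo (0 : ℝ) 1)) (borel EReal)
          (assouadSpectrumMap X)) ∧
      ∀ f : NonemptyCompacts X × Ioo (0 : ℝ) 1 → ℝ,
        (∀ p, (f p : EReal) = assouadSpectrumMap X p) →
          IsBaireClass 2 f ∧
          @Measurable _ _ (borel (NonemptyCompacts X × Ioo (0 : ℝ) 1)) (borel ℝ) f) ∧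
    (∃ (X : Type) (_ : MetricSpace X) (_ : CompactSpace X) (_ : Nonempty X)
      (f : NonemptyCompacts X × Ioo (0 : ℝ) 1 → ℝ),
        (∀ p, (f p : EReal) = assouadSpectrumMap X p) ∧
          ¬ IsBaireClass 1 f ∧ ¬ IsBaireClass 1 (assouadSpectrumMap X)) := by
  refine ⟨fun X _ _ _ => ⟨⟨isBaireClass_two_assouadSpectrumMap X, ?_⟩, fun f hf =>
    ⟨isBaireClass_two_of_coe_eq_assouadSpectrumMap hf, ?_⟩⟩, Icc (0 : ℝ) 1, inferInstance,
    inferInstance, inferInstance, fun p => (assouadSpectrumMap (Icc (0 : ℝ) 1) p).toReal,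
    coe_toReal_assouadSpectrumMap_unitInterval, fun h => ?_,
    not_isBaireClass_one_assouadSpectrumMap_unitInterval⟩
  · exact (isBaireClass_two_assouadSpectrumMap X).measurable_borel
  · exact (isBaireClass_two_of_coe_eq_assouadSpectrumMap hf).measurable_borel
  · refine not_isBaireClass_one_assouadSpectrumMap_unitInterval ?_
    rw [← funext coe_toReal_assouadSpectrumMap_unitInterval]
    exact h.continuous_comp continuous_coe_real_ereal
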